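/- Let $K\subset\mathbb C$ be an arbitrary non-empty compact set, let $(\Omega,\mathcal A)$ be a measurable space, and let $f:\Omega\times K\to\mathbb C$ be a random function, that is, $f(\cdot,z)$ is measurable for each $z\in K$. Suppose that for each $\omega\in\Omega$ there are an open neighborhood $U_\omega$ of $K$ and a holomorphic function $g_\omega:U_\omega\to\mathbb C$ (both possibly depending on $\omega$) with $g_\omega|_K=f(\omega,\cdot)$. Then there is a sequence $(r_j)_j$ of random rational functions pole-free on $K$ such that, for each $\omega\in\Omega$, $r_j(\omega,\cdot)\to f(\omega,\cdot)$ uniformly on $K$ as $j\to\infty$. Here a random rational function pole-free on $K$ is a function $r:\Omega\times K\to\mathbb C$ such that $r(\cdot,z)$ is measurable for each $z\in K$ and, for each $\omega\in\Omega$, the function $r(\omega,\cdot)$ is the restriction to $K$ of a rational function without poles on $K$. -/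

import Mathlib

open Filter Topology

/-- A random function on `X` with values in `Z`: a map `Ω × X → Z` (in curried form) that is
measurable in `ω` for each fixed `x`. No joint measurability is asked. -/
def IsRandomFunction {Ω X Z : Type*} [MeasurableSpace Ω] [MeasurableSpace Z]
    (f : Ω → X → Z) : Prop :=
  ∀ x : X, Measurable fun ω => f ω x

/-- `h : K → ℂ` is (the restriction to `K` of) a rational function `p / q` pole-free on `K`. -/
def IsRationalPoleFreeOn (K : Set ℂ) (h : K → ℂ) : Prop :=
  ∃ p q : Polynomial ℂ, q ≠ 0 ∧ (∀ z : K, q.eval (z : ℂ) ≠ 0) ∧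
    ∀ z : K, h z = p.eval (z : ℂ) / q.eval (z : ℂ)

/-- A random rational function pole-free on `K`: a random function `Ω × K → ℂ` such that each
`r ω` is a rational function pole-free on `K` (degrees and poles may depend on `ω`). -/
def IsRandomRationalPoleFreeOn {Ω : Type*} [MeasurableSpace Ω] (K : Set ℂ)
    (r : Ω → K → ℂ) : Prop :=
  IsRandomFunction r ∧ ∀ ω : Ω, IsRationalPoleFreeOn K (r ω)

/-! The rational functions pole-free on `K` form a separable subspace of `C(K, ℂ)`, so a countable
family `q` is dense in it, and Runge's theorem puts every `f ω` in the closure of `q`. Taking for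
each `j` the least index whose member is within `1 / (j + 1)` of `f ω` makes the choice measurable
in `ω`. Runge's theorem needs no contour: cut `g` off to a compactly supported `C¹` function `h`.
Cauchy–Pompeiu writes `h` on `K` as a Bochner integral in `C(K, ℂ)` of functions with at most one
simple pole, located off `K`; a closed subspace contains such integrals. -/

/-! ### Cauchy–Pompeiu formula -/

open MeasureTheory Set in
/-- Integrability of a continuous function on the polar strip, if it vanishes for large radii. -/
theorem integrableOn_polarCoord_target_of_continuous {A : ℝ × ℝ → ℂ} (hA : Continuous A) (R : ℝ)
    (hR : ∀ p : ℝ × ℝ, R < p.1 → A p = 0) : IntegrableOn A polarCoord.target := by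
  have hc : IntegrableOn A (Icc 0 R ×ˢ Icc (-Real.pi) Real.pi) :=
    hA.continuousOn.integrableOn_compact (isCompact_Icc.prod isCompact_Icc)
  refine IntegrableOn.of_forall_sdiff_eq_zero hc polarCoord.open_target.measurableSet ?_
  rintro ⟨r, θ⟩ ⟨h1, h2⟩
  apply hR
  by_contra! h
  simp only [polarCoord_target, mem_prod, mem_Ioi, mem_Ioo] at h1
  exact h2 ⟨⟨h1.1.le, h⟩, ⟨h1.2.1.le, h1.2.2.le⟩⟩

open MeasureTheory Set Complex in
/-- The Cauchy–Pompeiu formula for compactly supported functions of class `C¹`. -/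
theorem integral_dbar_div_sub_eq {h : ℂ → ℂ} (hh : ContDiff ℝ 1 h) (hs : HasCompactSupport h)
    (z : ℂ) :
    ∫ w, (fderiv ℝ h w 1 + I * fderiv ℝ h w I) / (w - z) = -(2 * Real.pi) * h z := by
  have hd : Continuous (fderiv ℝ h) := hh.continuous_fderiv one_ne_zero
  obtain ⟨R, hR⟩ : ∃ R : ℝ, ∀ w, R < ‖w - z‖ → w ∉ tsupport h := by
    obtain ⟨R, hR⟩ := hs.isCompact.isBounded.subset_closedBall z
    refine ⟨R, fun w hw hmem => ?_⟩
    have := hR hmem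
    rw [mem_closedBall_iff_norm] at this
    linarith
  have hzero : ∀ w, R < ‖w - z‖ → fderiv ℝ h w = 0 := fun w hw => by
    by_contra hne
    exact hR w hw (support_fderiv_subset ℝ hne)
  have hzero' : ∀ w, R < ‖w - z‖ → h w = 0 := fun w hw => image_eq_zero_of_notMem_tsupport (hR w hw)
  set c : ℝ × ℝ → ℂ := fun p => z + p.1 * exp (p.2 * I) with hcdef
  have hc : Continuous c := by fun_prop
  have hcn : ∀ p : ℝ × ℝ, R < p.1 → R < ‖c p - z‖ := fun p hp => by
    simp only [hcdef, add_sub_cancel_left, norm_mul, norm_exp_ofReal_mul_I, mul_one, norm_real,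
      Real.norm_eq_abs]
    exact hp.trans_le (le_abs_self _)
  -- In polar coordinates about `z`, the Jacobian `r` cancels the singularity and the integrand
  -- becomes `A + B`. Here `A` is the radial derivative of `h`, integrating to `-h z` on each ray,
  -- and `r * B` is `I` times the angular derivative, integrating to `0` on each circle by
  -- periodicity.
  set A : ℝ × ℝ → ℂ := fun p => fderiv ℝ h (c p) (exp (p.2 * I)) with hAdef
  set B : ℝ × ℝ → ℂ := fun p => I * fderiv ℝ h (c p) (I * exp (p.2 * I)) with hBdef
  have hA : Continuous A := (hd.comp hc).clm_apply (by fun_prop)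
  have hB : Continuous B := continuous_const.mul ((hd.comp hc).clm_apply (by fun_prop))
  have hAi : IntegrableOn A polarCoord.target :=
    integrableOn_polarCoord_target_of_continuous hA R fun p hp => by
      simp [hAdef, hzero _ (hcn p hp)]
  have hBi : IntegrableOn B polarCoord.target :=
    integrableOn_polarCoord_target_of_continuous hB R fun p hp => by
      simp [hBdef, hzero _ (hcn p hp)]
  have hderr : ∀ r θ : ℝ, HasDerivAt (fun s : ℝ => h (c (s, θ))) (A (r, θ)) r := fun r θ => by
    have h1 : HasDerivAt (fun s : ℝ => c (s, θ)) (exp (θ * I)) r := by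
      have h2 := ((hasDerivAt_id r).ofReal_comp.mul_const (exp (θ * I))).const_add z
      rwa [ofReal_one, one_mul] at h2
    exact ((hh.differentiable one_ne_zero _).hasFDerivAt).comp_hasDerivAt r h1
  have hderθ : ∀ r θ : ℝ, HasDerivAt (fun s : ℝ => h (c (r, s)))
      (r * fderiv ℝ h (c (r, θ)) (I * exp (θ * I))) θ := fun r θ => by
    have h1 : HasDerivAt (fun s : ℝ => c (r, s)) (r • (I * exp (θ * I))) θ := by
      have h2 : HasDerivAt (fun s : ℝ => exp (s * I)) (exp (θ * I) * I) θ := by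
        simpa using (((hasDerivAt_id θ).ofReal_comp).mul_const I).cexp
      have h3 := (h2.const_mul (r : ℂ)).const_add z
      rwa [mul_comm (exp _) I, ← real_smul] at h3
    have h4 := ((hh.differentiable one_ne_zero (c (r, θ))).hasFDerivAt).comp_hasDerivAt θ h1
    rw [map_smul, real_smul] at h4
    exact h4
  have htarget : polarCoord.target = Ioi (0 : ℝ) ×ˢ Ioo (-Real.pi) Real.pi := rfl
  have hIA : ∫ p in polarCoord.target, A p = -(2 * Real.pi) * h z := by
    rw [htarget, Measure.volume_eq_prod, ← Measure.prod_restrict, integral_prod_symm]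
    · have hin : ∀ θ : ℝ, ∫ r in Ioi (0 : ℝ), A (r, θ) = - h z := fun θ => by
        have hev : ∀ᶠ r : ℝ in atTop, h (c (r, θ)) = 0 :=
          (eventually_gt_atTop R).mono fun r hr => hzero' _ (hcn (r, θ) hr)
        have hint : IntegrableOn (fun r => A (r, θ)) (Ioi 0) := by
          have h1 : IntegrableOn (fun r => A (r, θ)) (Icc 0 R) :=
            (hA.comp (by fun_prop : Continuous fun r : ℝ => (r, θ))).continuousOn.integrableOn_Icc
          refine h1.of_forall_sdiff_eq_zero measurableSet_Ioi ?_
          rintro r ⟨hr0, hr⟩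
          have : R < r := by
            by_contra! hle
            exact hr ⟨le_of_lt hr0, hle⟩
          simp [hAdef, hzero _ (hcn (r, θ) this)]
        rw [integral_Ioi_of_hasDerivAt_of_tendsto' (fun r _ => hderr r θ) hint
          (tendsto_const_nhds.congr' (hev.mono fun _ hx => hx.symm))]
        simp [hcdef]
      simp only [hin]
      rw [setIntegral_const, Real.volume_real_Ioo_of_le (by linarith [Real.pi_pos])]
      rw [real_smul]; push_cast; ring
    · rw [Measure.prod_restrict]; exact hAi
  have hIB : ∫ p in polarCoord.target, B p = 0 := by
    rw [htarget, Measure.volume_eq_prod, setIntegral_prod _ (by exact hBi)]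
    refine setIntegral_eq_zero_of_forall_eq_zero fun r hr => ?_
    have hr0 : (r : ℂ) ≠ 0 := by exact_mod_cast (ne_of_gt hr)
    have key : ∫ θ in Ioo (-Real.pi) Real.pi, r * fderiv ℝ h (c (r, θ)) (I * exp (θ * I)) = 0 := by
      rw [← integral_Ioc_eq_integral_Ioo,
        ← intervalIntegral.integral_of_le (by linarith [Real.pi_pos]),
        intervalIntegral.integral_eq_sub_of_hasDerivAt (fun θ _ => hderθ r θ)]
      · have : c (r, Real.pi) = c (r, -Real.pi) := by
          simp [hcdef, exp_neg, exp_pi_mul_I]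
        rw [this, sub_self]
      · refine Continuous.intervalIntegrable (continuous_const.mul ?_) _ _
        exact (hd.comp (hc.comp (by fun_prop : Continuous fun θ : ℝ => (r, θ)))).clm_apply
          (by fun_prop)
    rw [integral_const_mul] at key
    simp only [hBdef]
    rw [integral_const_mul, (mul_eq_zero.mp key).resolve_left hr0, mul_zero]
  have hpolar : ∫ w, (fderiv ℝ h w 1 + I * fderiv ℝ h w I) / (w - z)
      = ∫ p in polarCoord.target, (A p + B p) := by
    rw [← integral_add_left_eq_self _ z, ← Complex.integral_comp_polarCoord_symm]
    refine setIntegral_congr_fun polarCoord.open_target.measurableSet ?_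
    rintro ⟨r, θ⟩ hp
    have hr : 0 < r := hp.1
    have hr0 : (r : ℂ) ≠ 0 := by exact_mod_cast hr.ne'
    have hsymm : Complex.polarCoord.symm (r, θ) = r * exp (θ * I) := by
      rw [Complex.polarCoord_symm_apply, exp_mul_I]; push_cast; rfl
    have hlin : ∀ v : ℂ, fderiv ℝ h (c (r, θ)) v
        = v.re * fderiv ℝ h (c (r, θ)) 1 + v.im * fderiv ℝ h (c (r, θ)) I := fun v => by
      have hv : v = v.re • (1 : ℂ) + v.im • I := by simp [re_add_im]
      conv_lhs => rw [hv]
      rw [map_add, map_smul, map_smul, real_smul, real_smul]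
    simp only [hsymm, add_sub_cancel_left, hAdef, hBdef, real_smul]
    rw [hlin (exp (θ * I)), hlin (I * exp (θ * I))]
    have he : exp (θ * I) ≠ 0 := exp_ne_zero _
    have hcs : exp (θ * I) = Real.cos θ + Real.sin θ * I := by
      rw [exp_mul_I]; push_cast; rfl
    have hnorm : (Real.cos θ : ℂ) ^ 2 + (Real.sin θ : ℂ) ^ 2 = 1 := by
      exact_mod_cast Real.cos_sq_add_sin_sq θ
    have hre : (exp (θ * I)).re = Real.cos θ := exp_ofReal_mul_I_re θ
    have him : (exp (θ * I)).im = Real.sin θ := exp_ofReal_mul_I_im θ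
    simp only [mul_re, mul_im, I_re, I_im, hre, him]
    change (r : ℂ) * ((fderiv ℝ h (c (r, θ)) 1 + I * fderiv ℝ h (c (r, θ)) I) / _) = _
    generalize fderiv ℝ h (c (r, θ)) 1 = a
    generalize fderiv ℝ h (c (r, θ)) I = b
    rw [mul_div_assoc', mul_div_mul_left _ _ hr0, div_eq_iff he, hcs]
    simp only [ofReal_sub, ofReal_add, ofReal_mul, ofReal_zero, ofReal_one]
    linear_combination (-(a + I * b)) * hnorm +
      Real.sin θ * (a * Real.sin θ - b * Real.cos θ) * I_sq
  rw [hpolar, integral_add hAi hBi, hIA, hIB, add_zero]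

/-! ### Runge's theorem -/

/-- The rational functions pole-free on `K`, as a subspace of `C(K, ℂ)`. -/
def rationalPoleFreeSubmodule (K : Set ℂ) : Submodule ℂ C(K, ℂ) where
  carrier := {h | IsRationalPoleFreeOn K h}
  zero_mem' := ⟨0, 1, one_ne_zero, by simp, by simp⟩
  add_mem' := by
    rintro a b ⟨p, q, hq, hqK, ha⟩ ⟨p', q', hq', hqK', hb⟩
    refine ⟨p * q' + q * p', q * q', mul_ne_zero hq hq', fun z => ?_, fun z => ?_⟩
    · simpa using ⟨hqK z, hqK' z⟩
    · simp [ha z, hb z, div_add_div _ _ (hqK z) (hqK' z)]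
  smul_mem' := by
    rintro c a ⟨p, q, hq, hqK, ha⟩
    exact ⟨Polynomial.C c * p, q, hq, hqK, fun z => by simp [ha z, mul_div_assoc]⟩

open MeasureTheory in
/-- A closed subspace contains the Bochner integral of every function with values in it. -/
theorem Submodule.integral_mem_of_isClosed {α E : Type*} [MeasurableSpace α] {μ : Measure α}
    [NormedAddCommGroup E] [NormedSpace ℂ E] [CompleteSpace E] {S : Submodule ℂ E}
    (hS : IsClosed (S : Set E)) {F : α → E} (hF : ∀ x, F x ∈ S) : ∫ x, F x ∂μ ∈ S := by
  by_cases hi : Integrable F μ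
  swap
  · rw [integral_undef hi]; exact S.zero_mem
  -- The quotient map by `S` commutes with the integral and kills the integrand.
  rw [← S.ker_mkQ, LinearMap.mem_ker]
  have h := S.mkQL.integral_comp_comm hi
  simpa [(Submodule.Quotient.mk_eq_zero S).mpr (hF _)] using h.symm

/-- A function holomorphic near a compact set agrees near it with a compactly supported function
of class `C¹`. -/
theorem exists_contDiff_hasCompactSupport_eqOn_nhdsSet {K U : Set ℂ} {g : ℂ → ℂ}
    (hK : IsCompact K) (hU : IsOpen U) (hKU : K ⊆ U) (hg : DifferentiableOn ℂ g U) :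
    ∃ h : ℂ → ℂ, ContDiff ℝ 1 h ∧ HasCompactSupport h ∧ h =ᶠ[𝓝ˢ K] g := by
  obtain ⟨L, hL, hKL, hLU⟩ := exists_compact_between hK hU hKU
  obtain ⟨φ, hφ1, hφ0, -⟩ := exists_contMDiffMap_one_nhds_of_subset_interior
    (modelWithCornersSelf ℝ ℂ) (n := 1) hK.isClosed hKL
  have hsub : tsupport (fun w => φ w • g w) ⊆ L := by
    refine closure_minimal (fun w hw => ?_) hL.isClosed
    by_contra hwL
    exact hw (by simp [hφ0 w hwL])
  refine ⟨fun w => φ w • g w, ?_, hL.of_isClosed_subset (isClosed_tsupport _) hsub,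
    hφ1.mono fun w hw => by simp [hw]⟩
  rw [contDiff_iff_contDiffAt]
  intro w
  by_cases hw : w ∈ U
  · exact φ.contMDiff.contDiff.contDiffAt.smul
      ((hg.contDiffOn hU).contDiffAt (hU.mem_nhds hw) |>.restrict_scalars ℝ)
  · have hw' : w ∉ tsupport (fun w => φ w • g w) := fun h => hw (hLU (hsub h))
    exact (contDiffAt_const (c := (0 : ℂ))).congr_of_eventuallyEq
      (notMem_tsupport_iff_eventuallyEq.mp hw')

open MeasureTheory in
/-- Runge's theorem: a function holomorphic near a compact set `K` is a uniform limit on `K` of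
rational functions pole-free on `K`. -/
theorem mem_closure_rationalPoleFreeSubmodule {K U : Set ℂ} [CompactSpace K] {g : ℂ → ℂ}
    (hU : IsOpen U) (hKU : K ⊆ U) (hg : DifferentiableOn ℂ g U) (f : C(K, ℂ))
    (hf : ∀ z : K, f z = g z) : f ∈ (rationalPoleFreeSubmodule K).topologicalClosure := by
  have hK : IsCompact K := isCompact_iff_compactSpace.mpr inferInstance
  obtain ⟨h, hh, hs, hhg⟩ := exists_contDiff_hasCompactSupport_eqOn_nhdsSet hK hU hKU hg
  set ψ : ℂ → ℂ := fun w => fderiv ℝ h w 1 + Complex.I * fderiv ℝ h w Complex.I with hψdef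
  have hd : Continuous (fderiv ℝ h) := hh.continuous_fderiv one_ne_zero
  have hψ : Continuous ψ := by fun_prop
  have hψs : HasCompactSupport ψ := by
    refine (hs.fderiv ℝ).mono fun w hw => ?_
    contrapose! hw
    simp only [Function.mem_support, not_not] at hw
    simp [hψdef, hw]
  -- Cauchy–Riemann: `h` agrees with the holomorphic `g` near `K`.
  have hψ0 : ∀ z ∈ K, ψ =ᶠ[𝓝 z] 0 := fun z hz => by
    have h1 : ∀ᶠ w in 𝓝 z, h w = g w := hhg.filter_mono (nhds_le_nhdsSet hz)
    filter_upwards [h1.eventually_nhds, hU.mem_nhds (hKU hz)] with w hw hwU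
    have hgw := (hg.differentiableAt (hU.mem_nhds hwU)).hasFDerivAt.restrictScalars ℝ
    have hhw := (hgw.congr_of_eventuallyEq hw).fderiv
    have hI : fderiv ℂ g w Complex.I = Complex.I * fderiv ℂ g w 1 := by
      rw [← smul_eq_mul, ← map_smul, smul_eq_mul, mul_one]
    simp only [hψdef, hhw, ContinuousLinearMap.coe_restrictScalars', hI, Pi.zero_apply]
    rw [← mul_assoc, Complex.I_mul_I]
    ring
  -- The denominator vanishes only when `w ∈ K`, and `ψ` is zero near such `w`.
  have hjoint : Continuous fun x : ℂ × K => ψ x.1 / (x.1 - x.2) := by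
    rw [continuous_iff_continuousAt]
    rintro ⟨w, z⟩
    by_cases hw : w ∈ K
    · have : (fun x : ℂ × K => ψ x.1 / (x.1 - x.2)) =ᶠ[𝓝 (w, z)] fun _ => 0 := by
        filter_upwards [(continuous_fst.tendsto (w, z)).eventually (hψ0 w hw)] with x hx
        simp [hx]
      exact continuousAt_const.congr this.symm
    · refine ContinuousAt.div (by fun_prop) (by fun_prop) ?_
      exact sub_ne_zero.mpr fun (h : w = z) => hw (h.symm ▸ z.2)
  set F : C(ℂ, C(K, ℂ)) := ContinuousMap.curry ⟨_, hjoint⟩ with hFdef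
  have hFapply : ∀ w z, F w z = ψ w / (w - z) := fun _ _ => rfl
  have hFi : Integrable F := by
    refine F.continuous.integrable_of_hasCompactSupport (hψs.mono fun w hw => ?_)
    contrapose! hw
    simp only [Function.mem_support, not_not] at hw ⊢
    ext z
    simp [hFapply, hw]
  have hFmem : ∀ w, F w ∈ rationalPoleFreeSubmodule K := fun w => by
    by_cases hw : w ∈ K
    · have : F w = 0 := by
        ext z
        simp [hFapply, (hψ0 w hw).self_of_nhds]
      rw [this]; exact Submodule.zero_mem _
    · refine ⟨Polynomial.C (ψ w), Polynomial.C w - Polynomial.X, ?_, fun z => ?_, fun z => ?_⟩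
      · rw [← neg_sub, neg_ne_zero]; exact Polynomial.X_sub_C_ne_zero w
      · simpa using sub_ne_zero.mpr fun (h : w = z) => hw (h.symm ▸ z.2)
      · simp [hFapply]
  have hint : ∫ w, F w ∈ (rationalPoleFreeSubmodule K).topologicalClosure :=
    Submodule.integral_mem_of_isClosed (Submodule.isClosed_topologicalClosure _)
      fun w => Submodule.le_topologicalClosure _ (hFmem w)
  have hfeq : f = (-(2 * Real.pi : ℂ))⁻¹ • ∫ w, F w := by
    ext z
    have h1 : (∫ w, F w) z = ∫ w, F w z :=
      ((ContinuousMap.evalCLM ℂ z).integral_comp_comm hFi).symm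
    have hz : h z = g z := hhg.self_of_nhdsSet z.2
    rw [ContinuousMap.smul_apply, h1]
    simp only [hFapply, hψdef]
    rw [integral_dbar_div_sub_eq hh hs, hf, hz, smul_eq_mul, inv_mul_cancel_left₀]
    simp
  rw [hfeq]
  exact Submodule.smul_mem _ _ hint

/-! ### Measurable selection -/

/-- If every value of a random function is continuous and belongs to the closure of a fixed
countable family, then the function is a limit of random functions with values in that family. -/
theorem exists_random_approximation_of_mem_closure_range {Ω X : Type*} [MeasurableSpace Ω]
    [TopologicalSpace X] [CompactSpace X] [TopologicalSpace.SeparableSpace X]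
    {f : Ω → C(X, ℂ)} (hf : IsRandomFunction fun ω x => f ω x) (q : ℕ → C(X, ℂ))
    (hq : ∀ ω, f ω ∈ closure (Set.range q)) :
    ∃ n : ℕ → Ω → ℕ, (∀ j, Measurable (n j)) ∧
      ∀ ω, Tendsto (fun j => q (n j ω)) atTop (𝓝 (f ω)) := by
  classical
  have hex : ∀ (j : ℕ) (ω : Ω), ∃ n, dist (f ω) (q n) ≤ 1 / ((j : ℝ) + 1) := fun j ω => by
    obtain ⟨_, ⟨n, rfl⟩, hn⟩ := Metric.mem_closure_iff.mp (hq ω) (1 / ((j : ℝ) + 1))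
      (by positivity)
    exact ⟨n, hn.le⟩
  refine ⟨fun j ω => Nat.find (hex j ω), fun j => measurable_find _ fun n => ?_, fun ω => ?_⟩
  · obtain ⟨D, hDc, hD⟩ := TopologicalSpace.exists_countable_dense X
    -- By continuity, the sup-norm bound need only be tested on a countable dense set, hence by
    -- countably many measurable conditions.
    have hset : {ω | dist (f ω) (q n) ≤ 1 / ((j : ℝ) + 1)}
        = ⋂ x ∈ D, {ω | dist (f ω x) (q n x) ≤ 1 / ((j : ℝ) + 1)} := by
      ext ω
      simp only [Set.mem_ofPred_eq, Set.mem_iInter]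
      rw [ContinuousMap.dist_le (by positivity)]
      refine ⟨fun h x _ => h x, fun h x => ?_⟩
      have hcl : IsClosed {x | dist (f ω x) (q n x) ≤ 1 / ((j : ℝ) + 1)} :=
        isClosed_le (by fun_prop) continuous_const
      exact hcl.closure_subset_iff.mpr h (hD x)
    rw [hset]
    exact MeasurableSet.biInter hDc fun x _ =>
      measurableSet_le ((hf x).dist measurable_const) measurable_const
  · rw [tendsto_iff_dist_tendsto_zero]
    refine squeeze_zero (fun _ => dist_nonneg) (fun j => ?_)
      (tendsto_one_div_add_atTop_nhds_zero_nat (𝕜 := ℝ))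
    rw [dist_comm]
    exact Nat.find_spec (hex j ω)

theorem mainTheorem1 {Ω : Type*} [MeasurableSpace Ω] (K : Set ℂ) (hK : IsCompact K)
    (hKne : K.Nonempty) (f : Ω → K → ℂ) (hf : IsRandomFunction f)
    (hext : ∀ ω : Ω, ∃ (U : Set ℂ) (g : ℂ → ℂ), IsOpen U ∧ K ⊆ U ∧
      DifferentiableOn ℂ g U ∧ ∀ z : K, f ω z = g z) :
    ∃ r : ℕ → Ω → K → ℂ, (∀ j : ℕ, IsRandomRationalPoleFreeOn K (r j)) ∧
      ∀ ω : Ω, TendstoUniformly (fun j : ℕ => r j ω) (f ω) atTop := by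
  have : CompactSpace K := isCompact_iff_compactSpace.mp hK
  have hcont : ∀ ω, Continuous (f ω) := fun ω => by
    obtain ⟨U, g, -, hKU, hg, hfg⟩ := hext ω
    rw [show f ω = K.domRestrict g from funext hfg]
    exact (hg.continuousOn.mono hKU).domRestrict
  -- The dense set is taken inside the subspace, so that the approximants are themselves rational
  -- and pole-free.
  obtain ⟨t, ht, htc, hdense⟩ := (TopologicalSpace.IsSeparable.of_separableSpace
    (rationalPoleFreeSubmodule K : Set C(K, ℂ))).exists_countable_dense_subset
  have htne : t.Nonempty := closure_nonempty_iff.mp ⟨0, hdense (Submodule.zero_mem _)⟩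
  obtain ⟨q, rfl⟩ := htc.exists_eq_range htne
  obtain ⟨n, hn, hlim⟩ := exists_random_approximation_of_mem_closure_range
    (f := fun ω => ⟨f ω, hcont ω⟩) hf q fun ω => by
      obtain ⟨U, g, hU, hKU, hg, hfg⟩ := hext ω
      exact closure_minimal hdense isClosed_closure
        (mem_closure_rationalPoleFreeSubmodule hU hKU hg ⟨f ω, hcont ω⟩ hfg)
  refine ⟨fun j ω => q (n j ω), fun j => ⟨fun z => ?_, fun ω => ht ⟨_, rfl⟩⟩, fun ω => ?_⟩
  · exact (measurable_from_nat (f := fun k => q k z)).comp (hn j)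
  · exact ContinuousMap.tendsto_iff_tendstoUniformly.mp (hlim ω)
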